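/- Let $W:[0,1]^2\to[0,1]$ be a graphon, i.e. a measurable function (not assumed symmetric), that is not almost everywhere zero. Write $\|Y\|_{\mathrm F}=\big(\iint_{[0,1]^2} Y(x,y)^2\,dx\,dy\big)^{1/2}$ and $\|Y\|_\square=\sup_{U,V}\big|\int_U\int_V Y(x,y)\,dx\,dy\big|$, the supremum being over measurable $U,V\subseteq[0,1]$. A singular triplet of $W$ is $(\sigma,u,v)$ with $\sigma\in\mathbb R$ and unit vectors $u,v\in L^2[0,1]$ such that $\int_0^1 W(x,y)v(y)\,dy=\sigma u(x)$ for a.e. $x$ and $\int_0^1 W(x,y)u(x)\,dx=\sigma v(y)$ for a.e. $y$ (so $u$ and $v$ are eigenvectors of $WW^\top$ and $W^\top W$ with eigenvalue $\sigma^2$). Singular triplets $(\sigma_k,u_k,v_k)_{k=1}^m$ are called $m$ leading singular triplets of $W$ if $u_1,\dots,u_m$ are orthonormal, $v_1,\dots,v_m$ are orthonormal, $|\sigma_1|\ge\dots\ge|\sigma_m|$, and every singular triplet $(\tau,f,g)$ with $f\perp u_k$ and $g\perp v_k$ for all $k$ satisfies $|\tau|\le|\sigma_k|$ for all $k$. Then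 $m$ leading singular triplets of $W$ exist for every $m\in\mathbb N$. Moreover, let $K\ge 1$ be an integer, let $R\ge1$ be a real number with $K/R\in\mathbb N$, and let $m$ be sampled uniformly from $[K]=\{1,\dots,K\}$. Then with probability at least $1-\frac1R$ over the choice of $m$, for every choice of $m$ leading singular triplets $(\sigma_k,u_k,v_k)_{k=1}^m$ of $W$, the function $C^*(x,y)=\sum_{k=1}^m\sigma_k u_k(x)v_k(y)$ satisfies \[ \|W-C^*\|_\square<\|W\|_{\mathrm F}\sqrt{\frac RK}. \] -/

import Mathlib

open MeasureTheory ProbabilityTheory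

noncomputable section

/-- A (not necessarily symmetric) graphon: a measurable function `[0,1]² → [0,1]`. -/
structure Graphon where
  /-- the underlying function -/
  toFun : unitInterval × unitInterval → ℝ
  measurable_toFun : Measurable toFun
  mem_Icc : ∀ p, toFun p ∈ Set.Icc (0 : ℝ) 1

/-- The real Hilbert space `L²[0,1]`. -/
abbrev L2I : Type := Lp ℝ 2 (volume : Measure unitInterval)

/-- The Frobenius norm `(∬ Y(x,y)² dx dy)^(1/2)`. -/
def frobeniusNorm (Y : unitInterval × unitInterval → ℝ) : ℝ :=
  Real.sqrt (∫ p, Y p ^ 2)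

/-- The cut norm: the supremum of `|∫_U ∫_V Y(x,y) dx dy|` over all measurable
`U, V ⊆ [0,1]`. (For integrable `Y` this set of reals is bounded by `∬ |Y|`.) -/
def cutNorm (Y : unitInterval × unitInterval → ℝ) : ℝ :=
  sSup {r : ℝ | ∃ U V : Set unitInterval, MeasurableSet U ∧ MeasurableSet V ∧
    r = |∫ p in U ×ˢ V, Y p|}

/-- `(σ, u, v)` is a singular triplet of the integral operator with kernel `W`:
`u, v` are unit vectors with `W v = σ u` and `Wᵀ u = σ v`. In particular `u` is an eigenvector
of `W Wᵀ` and `v` one of `Wᵀ W`, both with eigenvalue `σ²`. The sign of `σ` is free. -/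
structure IsSingularTriplet (W : Graphon) (σ : ℝ) (u v : L2I) : Prop where
  norm_left : ‖u‖ = 1
  norm_right : ‖v‖ = 1
  apply_right : ∀ᵐ x : unitInterval, ∫ y : unitInterval, W.toFun (x, y) * v y = σ * u x
  apply_left : ∀ᵐ y : unitInterval, ∫ x : unitInterval, W.toFun (x, y) * u x = σ * v y

/-- `(σ_k, u_k, v_k)`, `k < m`, are `m` leading singular triplets of `W`: they are singular
triplets with orthonormal left and right vectors, ordered by magnitude, and every singular
triplet orthogonal to them has a singular value of at most their magnitude. -/
structure IsLeadingSingularTriplets (W : Graphon) {m : ℕ} (σ : Fin m → ℝ) (u v : Fin m → L2I) :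
    Prop where
  triplet : ∀ k, IsSingularTriplet W (σ k) (u k) (v k)
  orthonormal_left : Orthonormal ℝ u
  orthonormal_right : Orthonormal ℝ v
  antitone : ∀ i j, i ≤ j → |σ j| ≤ |σ i|
  leading : ∀ (τ : ℝ) (f g : L2I), IsSingularTriplet W τ f g →
    (∀ k, inner ℝ (u k) f = 0) → (∀ k, inner ℝ (v k) g = 0) → ∀ k, |τ| ≤ |σ k|

/-- The kernel `(x, y) ↦ ∑ₖ σ_k u_k(x) v_k(y)`. -/
def svdKernel {m : ℕ} (σ : Fin m → ℝ) (u v : Fin m → L2I) :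
    unitInterval × unitInterval → ℝ :=
  fun p => ∑ k, σ k * u k p.1 * v k p.2

end

/-! Let `T` be the integral operator of `W` and `S` the residual left after subtracting `m` leading
singular triplets. Bessel's inequality on each section of `W` gives `∑ ‖T eᵢ‖² ≤ ‖W‖_F²` for
orthonormal `eᵢ`, so `T` is Hilbert–Schmidt, hence compact. Then `‖S‖` is itself a singular value of
`T`, attained on unit vectors orthogonal to those extracted (`exists_singular_pair_svdResidual`).
Appending this pair proves existence by induction on `m`. For the bound, the leading property gives
`‖S‖ ≤ |σ_k|`, and Bessel on the `m + 1` right vectors gives `(m + 1)‖S‖² ≤ ‖W‖_F²`. Pairing `S`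
with indicators bounds the cut norm by `‖S‖`. With `n = K/R`, every `m ≥ n` satisfies `1/(m + 1) <
R/K`, and such `m` have probability at least `1 - 1/R`. -/

/-! ### Compact operators and singular pairs -/

-- The self-adjoint compact operator `S* S` has an eigenvalue of modulus `‖S* S‖ = ‖S‖²`; an
-- eigenvector `x` and its image `S x`, normalised, form the pair.
open scoped InnerProductSpace in
theorem IsCompactOperator.exists_singular_pair {E : Type*} [NormedAddCommGroup E]
    [InnerProductSpace ℝ E] [CompleteSpace E] {S : E →L[ℝ] E} (hS : IsCompactOperator S)
    (h0 : S ≠ 0) :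
    ∃ f g : E, ‖f‖ = 1 ∧ ‖g‖ = 1 ∧ S g = ‖S‖ • f ∧ S.adjoint f = ‖S‖ • g := by
  have hpos : 0 < ‖S‖ := norm_pos_iff.mpr h0
  set A : E →L[ℝ] E := S.adjoint ∘L S with hA
  have hAn : ‖A‖ = ‖S‖ * ‖S‖ := S.norm_adjoint_comp_self
  have hAc : IsCompactOperator A := hS.clm_comp S.adjoint
  have hAs : IsSelfAdjoint A := by
    rw [ContinuousLinearMap.isSelfAdjoint_iff', hA, ContinuousLinearMap.adjoint_comp,
      ContinuousLinearMap.adjoint_adjoint]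
  have hr := A.spectralRadius_eq_nnnorm hAs
  -- Over `ℝ` a spectrum may be empty, but then the spectral radius would be `0` rather than `‖S‖² >
  -- 0`.
  have hne : (spectrum ℝ A).Nonempty := by
    by_contra h
    rw [Set.not_nonempty_iff_eq_empty] at h
    have : spectralRadius ℝ A = 0 := by simp [spectralRadius, h]
    rw [this] at hr
    have : ‖A‖ = 0 := by
      have h2 : ‖A‖₊ = 0 := by exact_mod_cast hr.symm
      simpa using congrArg NNReal.toReal h2
    nlinarith
  obtain ⟨μ, hμ, hμr⟩ := spectrum.exists_nnnorm_eq_spectralRadius_of_nonempty hne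
  rw [hr] at hμr
  have hμn : |μ| = ‖A‖ := by
    have : ‖μ‖₊ = ‖A‖₊ := by exact_mod_cast hμr
    simpa using congrArg NNReal.toReal this
  have hμ0 : μ ≠ 0 := by
    rintro rfl
    rw [abs_zero, hAn] at hμn
    nlinarith
  obtain ⟨x, hx⟩ := ((hAc.hasEigenvalue_iff_mem_spectrum hμ0).2 hμ).exists_hasEigenvector
  have hxA : A x = μ • x := hx.apply_eq_smul
  have hxn : 0 < ‖x‖ := norm_pos_iff.mpr hx.2
  have hSx : ‖S x‖ ^ 2 = μ * ‖x‖ ^ 2 := by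
    have h1 : ⟪A x, x⟫_ℝ = ⟪S x, S x⟫_ℝ := by
      rw [hA, ContinuousLinearMap.comp_apply, ContinuousLinearMap.adjoint_inner_left]
    rw [hxA, real_inner_smul_left, real_inner_self_eq_norm_sq, real_inner_self_eq_norm_sq] at h1
    exact h1.symm
  have hμpos : 0 ≤ μ := by
    by_contra h
    have : μ * ‖x‖ ^ 2 < 0 := mul_neg_of_neg_of_pos (not_le.mp h) (by positivity)
    nlinarith [sq_nonneg ‖S x‖]
  have hμS : μ = ‖S‖ * ‖S‖ := by rw [← hAn, ← hμn, abs_of_nonneg hμpos]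
  have hSx' : ‖S x‖ = ‖S‖ * ‖x‖ := by
    rw [← sq_eq_sq₀ (norm_nonneg _) (by positivity), hSx, hμS]; ring
  refine ⟨(‖S‖⁻¹ * ‖x‖⁻¹) • S x, ‖x‖⁻¹ • x, ?_, ?_, ?_, ?_⟩
  · rw [norm_smul, hSx', Real.norm_of_nonneg (by positivity)]; field_simp
  · rw [norm_smul, Real.norm_of_nonneg (by positivity)]; field_simp
  · rw [map_smul, smul_smul]; congr 1; field_simp
  · have : S.adjoint (S x) = μ • x := hxA
    rw [map_smul, this, smul_smul, smul_smul, hμS]; congr 1; field_simp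

/-- A Hilbert–Schmidt operator is compact. -/
theorem HilbertBasis.isCompactOperator_of_summable {ι E : Type*} [NormedAddCommGroup E]
    [InnerProductSpace ℝ E] [CompleteSpace E] (b : HilbertBasis ι ℝ E) (T : E →L[ℝ] E)
    (hT : Summable fun i => ‖T (b i)‖ ^ 2) : IsCompactOperator T := by
  classical
  let P : Finset ι → (E →L[ℝ] E) := fun s => ∑ i ∈ s, (innerSL ℝ (b i)).smulRight (T (b i))
  have hPc : ∀ s, IsCompactOperator (P s) := fun s => by
    have : P s ∈ compactOperator (RingHom.id ℝ) E E := by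
      refine Submodule.sum_mem _ fun i _ => ?_
      have h1 : IsCompactOperator (innerSL ℝ (b i)) :=
        (isCompactOperator_id (E := ℝ)).comp_clm (innerSL ℝ (b i))
      exact h1.clm_comp ((ContinuousLinearMap.id ℝ ℝ).smulRight (T (b i)))
    exact this
  -- Cauchy–Schwarz and Bessel bound each finite sum over `t \ s`; the limit in `t` gives the bound
  -- for the tail, so the finite-rank `P s` converge to `T` in norm.
  have hbound : ∀ s x, ‖(T - P s) x‖ ≤ √(∑' i : {i // i ∉ s}, ‖T (b i)‖ ^ 2) * ‖x‖ := by
    intro s x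
    have hx : HasSum (fun i => inner ℝ (b i) x • T (b i)) (T x) := by
      have := (b.hasSum_repr x).mapL T
      simpa [b.repr_apply_apply] using this
    have hlim : Filter.Tendsto
        (fun t => ‖(∑ i ∈ t, inner ℝ (b i) x • T (b i)) - P s x‖) Filter.atTop
        (nhds ‖(T - P s) x‖) := (Filter.Tendsto.sub_const hx (P s x)).norm
    refine le_of_tendsto hlim ?_
    filter_upwards [Filter.eventually_ge_atTop s] with t hst
    have hd : (∑ i ∈ t, inner ℝ (b i) x • T (b i)) - P s x
        = ∑ i ∈ t \ s, inner ℝ (b i) x • T (b i) := by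
      rw [← Finset.sum_sdiff hst]
      simp [P]
    rw [hd]
    have hsum : ∑ i ∈ t \ s, ‖T (b i)‖ ^ 2 ≤ ∑' i : {i // i ∉ s}, ‖T (b i)‖ ^ 2 := by
      have hs' : Summable fun i : {i // i ∉ s} => ‖T (b i)‖ ^ 2 := hT.subtype _
      have := hs'.sum_le_tsum ((t \ s).subtype (· ∉ s)) (fun _ _ => by positivity)
      rw [Finset.sum_subtype_eq_sum_filter (f := fun i => ‖T (b i)‖ ^ 2)] at this
      rwa [Finset.filter_true_of_mem (by simp)] at this
    calc ‖∑ i ∈ t \ s, inner ℝ (b i) x • T (b i)‖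
        ≤ ∑ i ∈ t \ s, ‖T (b i)‖ * |inner ℝ (b i) x| :=
          (norm_sum_le _ _).trans_eq (by simp [norm_smul, mul_comm])
      _ ≤ √(∑ i ∈ t \ s, ‖T (b i)‖ ^ 2) * √(∑ i ∈ t \ s, |inner ℝ (b i) x| ^ 2) :=
          Real.sum_mul_le_sqrt_mul_sqrt _ _ _
      _ ≤ _ := by
        gcongr
        refine Real.sqrt_le_iff.mpr ⟨norm_nonneg _, ?_⟩
        simpa using b.orthonormal.sum_inner_products_le (x := x) (s := t \ s)
  refine isCompactOperator_of_tendsto (l := Filter.atTop) (F := P) ?_ (.of_forall hPc)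
  rw [tendsto_iff_norm_sub_tendsto_zero]
  have h0 : Filter.Tendsto (fun s : Finset ι => √(∑' i : {i // i ∉ s}, ‖T (b i)‖ ^ 2))
      Filter.atTop (nhds 0) := by
    simpa using (tendsto_tsum_compl_atTop_zero fun i => ‖T (b i)‖ ^ 2).sqrt
  refine squeeze_zero (fun _ => norm_nonneg _) (fun s => ?_) h0
  rw [norm_sub_rev]
  exact ContinuousLinearMap.opNorm_le_bound _ (Real.sqrt_nonneg _) (hbound s)

theorem Orthonormal.snoc {E : Type*} [NormedAddCommGroup E] [InnerProductSpace ℝ E] {m : ℕ}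
    {u : Fin m → E} (hu : Orthonormal ℝ u) {f : E} (hf : ‖f‖ = 1)
    (hfu : ∀ k, inner ℝ (u k) f = 0) : Orthonormal ℝ (Fin.snoc u f : Fin (m + 1) → E) := by
  refine ⟨fun i => ?_, fun i j hij => ?_⟩
  · induction i using Fin.lastCases <;> simp [hf, hu.1]
  · induction i using Fin.lastCases with
    | last =>
      induction j using Fin.lastCases with
      | last => exact absurd rfl hij
      | cast j => simpa [real_inner_comm] using hfu j
    | cast i =>
      induction j using Fin.lastCases with
      | last => simpa using hfu i
      | cast j => simpa using hu.2 (fun h => hij (by rw [h]))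

/-! ### Residual of a partial singular value decomposition -/

section Residual

variable {E : Type*} [NormedAddCommGroup E] [InnerProductSpace ℝ E]

/-- The operator `T - ∑ₖ σ_k ⟨v_k, ·⟩ u_k`. -/
noncomputable def svdResidual (T : E →L[ℝ] E) {m : ℕ} (σ : Fin m → ℝ) (u v : Fin m → E) :
    E →L[ℝ] E :=
  T - ∑ k, σ k • (innerSL ℝ (v k)).smulRight (u k)

theorem svdResidual_apply (T : E →L[ℝ] E) {m : ℕ} (σ : Fin m → ℝ) (u v : Fin m → E) (x : E) :
    svdResidual T σ u v x = T x - ∑ k, (σ k * inner ℝ (v k) x) • u k := by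
  simp [svdResidual, smul_smul]

theorem svdResidual_apply_of_orthogonal (T : E →L[ℝ] E) {m : ℕ} (σ : Fin m → ℝ)
    (u v : Fin m → E) {x : E} (hx : ∀ k, inner ℝ (v k) x = 0) :
    svdResidual T σ u v x = T x := by
  simp [svdResidual_apply, hx]

theorem svdResidual_isCompactOperator {T : E →L[ℝ] E} (hT : IsCompactOperator T) {m : ℕ}
    (σ : Fin m → ℝ) (u v : Fin m → E) : IsCompactOperator (svdResidual T σ u v) := by
  have : svdResidual T σ u v ∈ compactOperator (RingHom.id ℝ) E E := by
    refine Submodule.sub_mem _ hT (Submodule.sum_mem _ fun k _ => Submodule.smul_mem _ _ ?_)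
    have h1 : IsCompactOperator (innerSL ℝ (v k)) :=
      (isCompactOperator_id (E := ℝ)).comp_clm (innerSL ℝ (v k))
    exact h1.clm_comp ((ContinuousLinearMap.id ℝ ℝ).smulRight (u k))
  exact this

theorem exists_unit_orthogonal (hE : ¬ FiniteDimensional ℝ E) {m : ℕ} (u : Fin m → E) :
    ∃ f : E, ‖f‖ = 1 ∧ ∀ k, inner ℝ (u k) f = 0 := by
  have hfin : FiniteDimensional ℝ (Submodule.span ℝ (Set.range u)) :=
    FiniteDimensional.span_of_finite ℝ (Set.finite_range u)
  have hne : (Submodule.span ℝ (Set.range u))ᗮ ≠ ⊥ := fun h => by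
    rw [Submodule.orthogonal_eq_bot_iff] at h
    rw [h] at hfin
    exact hE (Submodule.topEquiv.finiteDimensional)
  obtain ⟨x, hx, hx0⟩ := Submodule.exists_mem_ne_zero_of_ne_bot hne
  have hxn : ‖x‖ ≠ 0 := norm_ne_zero_iff.mpr hx0
  refine ⟨‖x‖⁻¹ • x, by rw [norm_smul, norm_inv, norm_norm, inv_mul_cancel₀ hxn], fun k => ?_⟩
  rw [real_inner_smul_right, hx _ (Submodule.subset_span ⟨k, rfl⟩), mul_zero]

variable [CompleteSpace E]

theorem svdResidual_adjoint (T : E →L[ℝ] E) {m : ℕ} (σ : Fin m → ℝ) (u v : Fin m → E) :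
    (svdResidual T σ u v).adjoint = svdResidual T.adjoint σ v u := by
  symm
  rw [ContinuousLinearMap.eq_adjoint_iff]
  intro x y
  simp only [svdResidual_apply, inner_sub_left, inner_sub_right, sum_inner, inner_sum,
    real_inner_smul_left, real_inner_smul_right, ContinuousLinearMap.adjoint_inner_left]
  congr 1
  refine Finset.sum_congr rfl fun k _ => ?_
  rw [real_inner_comm x (u k)]; ring

/-- The component of `T x` along `u k` is `⟨T* u_k, x⟩ = σ_k ⟨v_k, x⟩`, exactly what the residual
subtracts. -/
theorem inner_svdResidual_eq_zero {T : E →L[ℝ] E} {m : ℕ} {σ : Fin m → ℝ} {u v : Fin m → E}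
    (hu : Orthonormal ℝ u) (hT' : ∀ k, T.adjoint (u k) = σ k • v k) (k : Fin m) (x : E) :
    inner ℝ (u k) (svdResidual T σ u v x) = 0 := by
  rw [svdResidual_apply, inner_sub_right, ← ContinuousLinearMap.adjoint_inner_left, hT',
    hu.inner_right_fintype, real_inner_smul_left, sub_self]

/-- The norm of the residual of a partial singular value decomposition is a singular value,
attained orthogonally to the vectors already extracted. -/
theorem exists_singular_pair_svdResidual (hE : ¬ FiniteDimensional ℝ E) {T : E →L[ℝ] E}
    (hTc : IsCompactOperator T) {m : ℕ} {σ : Fin m → ℝ} {u v : Fin m → E}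
    (hu : Orthonormal ℝ u) (hv : Orthonormal ℝ v)
    (hT : ∀ k, T (v k) = σ k • u k) (hT' : ∀ k, T.adjoint (u k) = σ k • v k) :
    ∃ f g : E, ‖f‖ = 1 ∧ ‖g‖ = 1 ∧ (∀ k, inner ℝ (u k) f = 0) ∧ (∀ k, inner ℝ (v k) g = 0) ∧
      T g = ‖svdResidual T σ u v‖ • f ∧ T.adjoint f = ‖svdResidual T σ u v‖ • g := by
  set S := svdResidual T σ u v with hS
  suffices h : ∃ f g : E, ‖f‖ = 1 ∧ ‖g‖ = 1 ∧ (∀ k, inner ℝ (u k) f = 0) ∧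
      (∀ k, inner ℝ (v k) g = 0) ∧ S g = ‖S‖ • f ∧ S.adjoint f = ‖S‖ • g by
    obtain ⟨f, g, hf, hg, hfu, hgv, h1, h2⟩ := h
    refine ⟨f, g, hf, hg, hfu, hgv, ?_, ?_⟩
    · rw [← h1, hS, svdResidual_apply_of_orthogonal T σ u v hgv]
    · rw [← h2, hS, svdResidual_adjoint, svdResidual_apply_of_orthogonal _ σ v u hfu]
  -- If `S = 0` the singular value is `0` and any orthogonal unit vectors serve; infinite dimension
  -- supplies them.
  by_cases h0 : S = 0
  · obtain ⟨f, hf, hfu⟩ := exists_unit_orthogonal hE u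
    obtain ⟨g, hg, hgv⟩ := exists_unit_orthogonal hE v
    exact ⟨f, g, hf, hg, hfu, hgv, by simp [h0], by simp [h0]⟩
  · obtain ⟨f, g, hf, hg, h1, h2⟩ :=
      (svdResidual_isCompactOperator hTc σ u v).exists_singular_pair h0
    have hpos : ‖S‖ ≠ 0 := norm_ne_zero_iff.mpr h0
    refine ⟨f, g, hf, hg, fun k => ?_, fun k => ?_, h1, h2⟩
    · have := inner_svdResidual_eq_zero hu hT' k g
      rw [← hS, h1, real_inner_smul_right] at this
      exact (mul_eq_zero.mp this).resolve_left hpos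
    -- The adjoint of the residual is the residual of the adjoint with `u` and `v` exchanged.
    · have := inner_svdResidual_eq_zero (T := T.adjoint) hv (σ := σ) (v := u)
        (by simpa using hT) k f
      rw [← svdResidual_adjoint, ← hS, h2, real_inner_smul_right] at this
      exact (mul_eq_zero.mp this).resolve_left hpos

end Residual

/-! ### The integral operator of a graphon -/

/-- Polynomials embed in `L²[0,1]`: a nonzero one has finitely many roots, a null set. -/
theorem not_finiteDimensional_L2I : ¬ FiniteDimensional ℝ L2I := by
  intro h
  let φ : Polynomial ℝ →ₗ[ℝ] L2I :=
    (ContinuousMap.toLp (E := ℝ) 2 (volume : Measure unitInterval) ℝ).toLinearMap ∘ₗ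
      (Polynomial.toContinuousMapOnAlgHom unitInterval).toLinearMap
  have hφ : Function.Injective φ := by
    refine (injective_iff_map_eq_zero φ).mpr fun p hp => ?_
    by_contra hp0
    have h0 : ∀ᵐ x : unitInterval, p.eval (x : ℝ) = 0 := by
      have h1 := ContinuousMap.coeFn_toLp (p := 2) (𝕜 := ℝ) (volume : Measure unitInterval)
        (Polynomial.toContinuousMapOnAlgHom unitInterval p)
      have h2 : (φ p : unitInterval → ℝ) =ᵐ[volume] 0 := by
        rw [hp]; exact Lp.coeFn_zero _ _ _
      filter_upwards [h1, h2] with x hx hx'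
      exact hx.symm.trans hx'
    have hfin : {x : unitInterval | p.eval (x : ℝ) = 0}.Finite :=
      (Polynomial.finite_setOfPred_isRoot hp0).preimage Subtype.val_injective.injOn
    have h3 : ∀ᵐ x : unitInterval, p.eval (x : ℝ) ≠ 0 := by
      have := hfin.measure_zero (volume : Measure unitInterval)
      simpa [ae_iff] using this
    obtain ⟨x, hx, hx'⟩ := (h0.and h3).exists
    exact hx' hx
  exact Polynomial.not_finite (R := ℝ) (Module.Finite.of_injective φ hφ)

namespace Graphon

variable (W : Graphon)

theorem norm_le_one (p : unitInterval × unitInterval) : ‖W.toFun p‖ ≤ 1 := by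
  rw [Real.norm_of_nonneg (W.mem_Icc p).1]
  exact (W.mem_Icc p).2

/-- The graphon with its two variables exchanged. -/
def transpose : Graphon where
  toFun p := W.toFun p.swap
  measurable_toFun := W.measurable_toFun.comp measurable_swap
  mem_Icc p := W.mem_Icc p.swap

theorem memLp_section (x : unitInterval) :
    MemLp (fun y => W.toFun (x, y)) 2 (volume : Measure unitInterval) :=
  MemLp.of_bound (W.measurable_toFun.comp measurable_prodMk_left).aestronglyMeasurable 1
    (.of_forall fun _ => W.norm_le_one _)

/-- The function `W(x, ·)` as an element of `L²[0,1]`. -/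
noncomputable def sectionL2 (x : unitInterval) : L2I := (W.memLp_section x).toLp _

theorem inner_sectionL2 (x : unitInterval) (v : L2I) :
    inner ℝ (W.sectionL2 x) v = ∫ y, W.toFun (x, y) * v y := by
  rw [L2.inner_def]
  refine integral_congr_ae ?_
  filter_upwards [(W.memLp_section x).coeFn_toLp] with y hy
  rw [sectionL2, hy]
  simp [mul_comm]

theorem norm_sectionL2_sq (x : unitInterval) :
    ‖W.sectionL2 x‖ ^ 2 = ∫ y, W.toFun (x, y) ^ 2 := by
  rw [← real_inner_self_eq_norm_sq, inner_sectionL2]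
  refine integral_congr_ae ?_
  filter_upwards [(W.memLp_section x).coeFn_toLp] with y hy
  rw [sectionL2, hy, sq]

theorem norm_sectionL2_le (x : unitInterval) : ‖W.sectionL2 x‖ ≤ 1 := by
  rw [← sq_le_one_iff₀ (norm_nonneg _), norm_sectionL2_sq]
  have := norm_integral_le_of_norm_le_const (μ := (volume : Measure unitInterval))
    (f := fun y => W.toFun (x, y) ^ 2) (C := 1)
    (.of_forall fun y => by
      rw [norm_pow]; exact pow_le_one₀ (norm_nonneg _) (W.norm_le_one _))
  simpa using (le_abs_self _).trans this

theorem memLp_inner_sectionL2 (v : L2I) :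
    MemLp (fun x => inner ℝ (W.sectionL2 x) v) 2 (volume : Measure unitInterval) := by
  refine MemLp.of_bound ?_ ‖v‖ (.of_forall fun x => ?_)
  · simp_rw [inner_sectionL2]
    have hm : StronglyMeasurable fun p : unitInterval × unitInterval => W.toFun p * v p.2 :=
      W.measurable_toFun.stronglyMeasurable.mul
        ((Lp.stronglyMeasurable v).comp_measurable measurable_snd)
    exact hm.integral_prod_right.aestronglyMeasurable
  · exact (norm_inner_le_norm _ _).trans
      (mul_le_of_le_one_left (norm_nonneg _) (W.norm_sectionL2_le x))

/-- The integral operator on `L²[0,1]` with kernel `W`. -/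
noncomputable def integralOperator : L2I →L[ℝ] L2I :=
  LinearMap.mkContinuous
    { toFun := fun v => (W.memLp_inner_sectionL2 v).toLp _
      map_add' := fun v w => by
        rw [← MemLp.toLp_add]
        exact MemLp.toLp_congr _ _ (.of_forall fun x => inner_add_right _ _ _)
      map_smul' := fun c v => by
        rw [RingHom.id_apply, ← MemLp.toLp_const_smul]
        exact MemLp.toLp_congr _ _ (.of_forall fun x => real_inner_smul_right _ _ _) }
    1 fun v => by
      have := Lp.norm_le_of_ae_bound (f := (W.memLp_inner_sectionL2 v).toLp _) (norm_nonneg v) (by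
        filter_upwards [(W.memLp_inner_sectionL2 v).coeFn_toLp] with x hx
        rw [hx]
        exact (norm_inner_le_norm _ _).trans
          (mul_le_of_le_one_left (norm_nonneg _) (W.norm_sectionL2_le x)))
      simpa [measureUnivNNReal] using this

theorem coeFn_integralOperator_eq_inner (v : L2I) :
    W.integralOperator v =ᵐ[volume] fun x => inner ℝ (W.sectionL2 x) v :=
  (W.memLp_inner_sectionL2 v).coeFn_toLp

theorem coeFn_integralOperator (v : L2I) :
    W.integralOperator v =ᵐ[volume] fun x => ∫ y, W.toFun (x, y) * v y := by
  simpa only [inner_sectionL2] using W.coeFn_integralOperator_eq_inner v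

theorem integralOperator_eq_smul_iff (σ : ℝ) (u v : L2I) :
    W.integralOperator v = σ • u ↔ ∀ᵐ x, ∫ y, W.toFun (x, y) * v y = σ * u x := by
  rw [Lp.ext_iff]
  have h1 := W.coeFn_integralOperator v
  have h2 := Lp.coeFn_smul σ u
  constructor <;> intro h
  · filter_upwards [h, h1, h2] with x a b c
    rw [← b, a, c]; simp
  · filter_upwards [h, h1, h2] with x a b c
    rw [b, a, c]; simp

theorem integrable_mul_mul (u v : L2I) :
    Integrable (fun p : unitInterval × unitInterval => W.toFun p * (u p.1 * v p.2)) := by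
  have hu : Integrable u := (Lp.memLp u).integrable (by norm_num)
  have hv : Integrable v := (Lp.memLp v).integrable (by norm_num)
  exact (hu.mul_prod hv).bdd_mul W.measurable_toFun.aestronglyMeasurable
    (.of_forall fun p => W.norm_le_one p)

theorem inner_integralOperator (u v : L2I) :
    inner ℝ u (W.integralOperator v)
      = ∫ p : unitInterval × unitInterval, W.toFun p * (u p.1 * v p.2) := by
  rw [Measure.volume_eq_prod, integral_prod _ (W.integrable_mul_mul u v), L2.inner_def]
  refine integral_congr_ae ?_
  filter_upwards [W.coeFn_integralOperator v] with x hx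
  rw [hx, RCLike.inner_apply', conj_trivial, ← integral_const_mul]
  refine integral_congr_ae (.of_forall fun y => ?_)
  ring

theorem adjoint_integralOperator :
    W.integralOperator.adjoint = W.transpose.integralOperator := by
  symm
  rw [ContinuousLinearMap.eq_adjoint_iff]
  intro u v
  rw [real_inner_comm, inner_integralOperator, inner_integralOperator, Measure.volume_eq_prod,
    ← integral_prod_swap]
  refine integral_congr_ae (.of_forall fun p => ?_)
  simp [transpose, mul_comm]

theorem integrable_sq : Integrable fun p => W.toFun p ^ 2 :=
  Integrable.of_bound (W.measurable_toFun.pow_const 2).aestronglyMeasurable 1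
    (.of_forall fun p => by rw [norm_pow]; exact pow_le_one₀ (norm_nonneg _) (W.norm_le_one _))

theorem frobeniusNorm_sq : frobeniusNorm W.toFun ^ 2 = ∫ p, W.toFun p ^ 2 :=
  Real.sq_sqrt (integral_nonneg fun _ => sq_nonneg _)

/-- Since `(T e)(x)` is the inner product of `e` with the section `W(x, ·)`, this is Bessel's
inequality at each `x`, integrated over `x`. -/
theorem sum_norm_integralOperator_sq_le {ι : Type*} {e : ι → L2I} (he : Orthonormal ℝ e)
    (s : Finset ι) :
    ∑ i ∈ s, ‖W.integralOperator (e i)‖ ^ 2 ≤ frobeniusNorm W.toFun ^ 2 := by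
  have hI : ∀ i, ‖W.integralOperator (e i)‖ ^ 2 = ∫ x, inner ℝ (W.sectionL2 x) (e i) ^ 2 := by
    intro i
    rw [← real_inner_self_eq_norm_sq, L2.inner_def]
    refine integral_congr_ae ?_
    filter_upwards [W.coeFn_integralOperator_eq_inner (e i)] with x hx
    rw [hx, RCLike.inner_apply', conj_trivial, sq]
  have hint : ∀ i, Integrable fun x => inner ℝ (W.sectionL2 x) (e i) ^ 2 := fun i =>
    (W.memLp_inner_sectionL2 (e i)).integrable_sq
  have hsq := W.integrable_sq
  rw [Measure.volume_eq_prod] at hsq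
  rw [frobeniusNorm_sq, Measure.volume_eq_prod, integral_prod _ hsq,
    Finset.sum_congr rfl fun i _ => hI i, ← integral_finsetSum _ fun i _ => hint i]
  refine integral_mono (integrable_finsetSum _ fun i _ => hint i) hsq.integral_prod_left
    fun x => ?_
  simp only
  rw [← norm_sectionL2_sq]
  have := he.sum_inner_products_le (x := W.sectionL2 x) (s := s)
  simpa [real_inner_comm] using this

theorem frobeniusNorm_pos (hW : ¬ W.toFun =ᵐ[volume] 0) : 0 < frobeniusNorm W.toFun := by
  refine Real.sqrt_pos.mpr ((integral_nonneg fun _ => sq_nonneg _).lt_of_ne' fun h => hW ?_)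
  rw [integral_eq_zero_iff_of_nonneg (fun _ => sq_nonneg _) W.integrable_sq] at h
  filter_upwards [h] with p hp
  simpa using hp

end Graphon

/-! ### Compactness and the cut norm -/

namespace Graphon

variable (W : Graphon)

theorem isCompactOperator_integralOperator : IsCompactOperator W.integralOperator := by
  obtain ⟨s, b, -⟩ := exists_hilbertBasis ℝ L2I
  exact b.isCompactOperator_of_summable _ <| summable_of_sum_le (fun _ => sq_nonneg _)
    fun t => W.sum_norm_integralOperator_sq_le b.orthonormal t

theorem isSingularTriplet_iff {σ : ℝ} {u v : L2I} :
    IsSingularTriplet W σ u v ↔ ‖u‖ = 1 ∧ ‖v‖ = 1 ∧ W.integralOperator v = σ • u ∧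
      W.integralOperator.adjoint u = σ • v := by
  rw [adjoint_integralOperator, integralOperator_eq_smul_iff, integralOperator_eq_smul_iff]
  exact ⟨fun h => ⟨h.1, h.2, h.3, h.4⟩, fun h => ⟨h.1, h.2.1, h.2.2.1, h.2.2.2⟩⟩

theorem inner_indicator_integralOperator_indicator {U V : Set unitInterval}
    (hU : MeasurableSet U) (hV : MeasurableSet V) :
    inner ℝ (indicatorConstLp 2 hU (measure_ne_top volume U) (1 : ℝ))
        (W.integralOperator (indicatorConstLp 2 hV (measure_ne_top volume V) (1 : ℝ)))
      = ∫ p in U ×ˢ V, W.toFun p := by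
  have hi : Integrable W.toFun (volume.prod volume) :=
    Integrable.of_bound W.measurable_toFun.aestronglyMeasurable 1 (.of_forall W.norm_le_one)
  rw [L2.inner_indicatorConstLp_one, Measure.volume_eq_prod, setIntegral_prod _ hi.integrableOn]
  refine integral_congr_ae (ae_restrict_of_ae ?_)
  filter_upwards [W.coeFn_integralOperator_eq_inner
    (indicatorConstLp 2 hV (measure_ne_top volume V) (1 : ℝ))] with x hx
  rw [hx, real_inner_comm, L2.inner_indicatorConstLp_one]
  exact integral_congr_ae (ae_restrict_of_ae (W.memLp_section x).coeFn_toLp)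

theorem inner_indicator_svdResidual_indicator {m : ℕ} (σ : Fin m → ℝ) (u v : Fin m → L2I)
    {U V : Set unitInterval} (hU : MeasurableSet U) (hV : MeasurableSet V) :
    inner ℝ (indicatorConstLp 2 hU (measure_ne_top volume U) (1 : ℝ))
        (svdResidual W.integralOperator σ u v
          (indicatorConstLp 2 hV (measure_ne_top volume V) (1 : ℝ)))
      = ∫ p in U ×ˢ V, W.toFun p - svdKernel σ u v p := by
  have hi : Integrable W.toFun (volume.prod volume) :=
    Integrable.of_bound W.measurable_toFun.aestronglyMeasurable 1 (.of_forall W.norm_le_one)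
  have hL : ∀ w : L2I, Integrable w := fun w => (Lp.memLp w).integrable (by norm_num)
  have hk : ∀ k, Integrable (fun p : unitInterval × unitInterval => σ k * u k p.1 * v k p.2)
      (volume.prod volume) := fun k => ((hL (u k)).const_mul (σ k)).mul_prod (hL (v k))
  rw [svdResidual_apply, inner_sub_right, inner_indicator_integralOperator_indicator, inner_sum,
    Measure.volume_eq_prod]
  unfold svdKernel
  rw [integral_sub hi.integrableOn (integrable_finsetSum _ fun k _ => (hk k).integrableOn),
    integral_finsetSum _ fun k _ => (hk k).integrableOn]
  congr 1
  refine Finset.sum_congr rfl fun k _ => ?_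
  rw [real_inner_smul_right, real_inner_comm, L2.inner_indicatorConstLp_one,
    L2.inner_indicatorConstLp_one, setIntegral_prod_mul (fun x => σ k * u k x) (v k),
    integral_const_mul]
  ring

theorem norm_indicator_one_le {U : Set unitInterval} (hU : MeasurableSet U) :
    ‖(indicatorConstLp 2 hU (measure_ne_top volume U) (1 : ℝ) : L2I)‖ ≤ 1 := by
  refine norm_indicatorConstLp_le.trans ?_
  rw [norm_one, one_mul]
  exact Real.rpow_le_one measureReal_nonneg measureReal_le_one (by norm_num)

/-- The cut norm of the residual kernel is at most the operator norm of the residual. -/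
theorem cutNorm_sub_svdKernel_le {m : ℕ} (σ : Fin m → ℝ) (u v : Fin m → L2I) :
    cutNorm (fun p => W.toFun p - svdKernel σ u v p)
      ≤ ‖svdResidual W.integralOperator σ u v‖ := by
  refine Real.sSup_le ?_ (norm_nonneg _)
  rintro r ⟨U, V, hU, hV, rfl⟩
  -- Each cut is a pairing of `S` with two indicators, whose norms are at most `1` on a probability
  -- space.
  rw [← inner_indicator_svdResidual_indicator W σ u v hU hV]
  refine (abs_real_inner_le_norm _ _).trans ?_
  refine (mul_le_of_le_one_left (norm_nonneg _) (norm_indicator_one_le hU)).trans ?_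
  exact (ContinuousLinearMap.le_opNorm _ _).trans
    (mul_le_of_le_one_right (norm_nonneg _) (norm_indicator_one_le hV))

end Graphon

/-! ### Extending and estimating leading triplets -/

namespace IsLeadingSingularTriplets

variable {W : Graphon} {m : ℕ} {σ : Fin m → ℝ} {u v : Fin m → L2I}

theorem exists_next (h : IsLeadingSingularTriplets W σ u v) :
    ∃ f g : L2I, IsSingularTriplet W ‖svdResidual W.integralOperator σ u v‖ f g ∧
      (∀ k, inner ℝ (u k) f = 0) ∧ ∀ k, inner ℝ (v k) g = 0 := by
  have ht := fun k => W.isSingularTriplet_iff.mp (h.triplet k)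
  obtain ⟨f, g, hf, hg, hfu, hgv, h1, h2⟩ := exists_singular_pair_svdResidual
    not_finiteDimensional_L2I W.isCompactOperator_integralOperator h.orthonormal_left
    h.orthonormal_right (fun k => (ht k).2.2.1) (fun k => (ht k).2.2.2)
  exact ⟨f, g, W.isSingularTriplet_iff.mpr ⟨hf, hg, h1, h2⟩, hfu, hgv⟩

/-- The pair attaining the residual norm is appended. Its value is at most the earlier ones by their
leading property, and it dominates all that remain because it is an operator norm. -/
theorem exists_snoc (h : IsLeadingSingularTriplets W σ u v) :
    ∃ (σ' : Fin (m + 1) → ℝ) (u' v' : Fin (m + 1) → L2I),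
      IsLeadingSingularTriplets W σ' u' v' := by
  obtain ⟨f, g, hfg, hfu, hgv⟩ := h.exists_next
  set τ := ‖svdResidual W.integralOperator σ u v‖ with hτ
  have hτ0 : 0 ≤ τ := norm_nonneg _
  refine ⟨Fin.snoc σ τ, Fin.snoc u f, Fin.snoc v g, ⟨fun k => ?_,
    h.orthonormal_left.snoc hfg.norm_left hfu,
    h.orthonormal_right.snoc hfg.norm_right hgv, fun i j hij => ?_,
    fun t p q hpq hp hq k => ?_⟩⟩
  · induction k using Fin.lastCases with
    | last => simpa using hfg
    | cast k => simpa using h.triplet k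
  · induction j using Fin.lastCases with
    | last =>
      induction i using Fin.lastCases with
      | last => exact le_rfl
      | cast i => simpa using h.leading τ f g hfg hfu hgv i
    | cast j =>
      induction i using Fin.lastCases with
      | last => exact absurd hij (not_le.mpr (Fin.castSucc_lt_last j))
      | cast i => simpa using h.antitone i j (by simpa using hij)
  · have hp' : ∀ k, inner ℝ (u k) p = 0 := fun k => by simpa using hp k.castSucc
    have hq' : ∀ k, inner ℝ (v k) q = 0 := fun k => by simpa using hq k.castSucc
    induction k using Fin.lastCases with
    | last =>
      obtain ⟨hpn, hqn, hT, -⟩ := W.isSingularTriplet_iff.mp hpq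
      have := (svdResidual W.integralOperator σ u v).le_opNorm q
      -- On `q`, orthogonal to the `v k`, the residual agrees with `T`, so `|t| = ‖S q‖ ≤ ‖S‖`.
      rw [svdResidual_apply_of_orthogonal _ _ _ _ hq', hT, norm_smul, hpn, hqn, mul_one, mul_one,
        Real.norm_eq_abs] at this
      simpa [abs_of_nonneg hτ0] using this
    | cast k => simpa using h.leading t p q hpq hp' hq' k

/-- The next singular value is `‖S‖`, and all `m` earlier ones are at least as large, so `m + 1`
squares fit below `‖W‖_F²`. -/
theorem succ_mul_norm_svdResidual_sq_le (h : IsLeadingSingularTriplets W σ u v) :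
    (m + 1) * ‖svdResidual W.integralOperator σ u v‖ ^ 2 ≤ frobeniusNorm W.toFun ^ 2 := by
  obtain ⟨f, g, hfg, hfu, hgv⟩ := h.exists_next
  have hlead := h.leading _ f g hfg hfu hgv
  set τ := ‖svdResidual W.integralOperator σ u v‖ with hτ
  have hle := W.sum_norm_integralOperator_sq_le
    (h.orthonormal_right.snoc hfg.norm_right hgv) Finset.univ
  have hnorm : ∀ {s : ℝ} {a b : L2I}, IsSingularTriplet W s a b →
      ‖W.integralOperator b‖ ^ 2 = s ^ 2 := fun {s a b} hs => by
    obtain ⟨ha, -, hT, -⟩ := W.isSingularTriplet_iff.mp hs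
    rw [hT, norm_smul, ha, mul_one, Real.norm_eq_abs, sq_abs]
  rw [Fin.sum_univ_castSucc] at hle
  simp only [Fin.snoc_castSucc, Fin.snoc_last, hnorm hfg, hnorm (h.triplet _)] at hle
  have hsum : (m : ℝ) * τ ^ 2 ≤ ∑ k, σ k ^ 2 := by
    have := Finset.card_nsmul_le_sum Finset.univ (fun k => σ k ^ 2) (τ ^ 2)
      fun k _ => sq_le_sq.mpr (hlead k)
    simpa using this
  linarith

theorem cutNorm_lt (h : IsLeadingSingularTriplets W σ u v) (hW : ¬ W.toFun =ᵐ[volume] 0)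
    {c : ℝ} (hc : 0 < c) (hcm : 1 < c * (m + 1)) :
    cutNorm (fun p => W.toFun p - svdKernel σ u v p) < frobeniusNorm W.toFun * √c := by
  have hF := W.frobeniusNorm_pos hW
  refine (W.cutNorm_sub_svdKernel_le σ u v).trans_lt ?_
  refine lt_of_pow_lt_pow_left₀ 2 (by positivity) ?_
  rw [mul_pow, Real.sq_sqrt hc.le]
  have hm := h.succ_mul_norm_svdResidual_sq_le
  have hm1 : (0 : ℝ) < m + 1 := by positivity
  refine lt_of_mul_lt_mul_left (hm.trans_lt ?_) hm1.le
  have : 0 < frobeniusNorm W.toFun ^ 2 := by positivity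
  nlinarith

end IsLeadingSingularTriplets

theorem exists_isLeadingSingularTriplets (W : Graphon) (m : ℕ) :
    ∃ (σ : Fin m → ℝ) (u v : Fin m → L2I), IsLeadingSingularTriplets W σ u v := by
  induction m with
  | zero =>
    exact ⟨Fin.elim0, Fin.elim0, Fin.elim0, ⟨fun k => k.elim0, ⟨fun k => k.elim0, fun k => k.elim0⟩,
      ⟨fun k => k.elim0, fun k => k.elim0⟩, fun k => k.elim0, fun _ _ _ _ _ _ k => k.elim0⟩⟩
  | succ m ih =>
    obtain ⟨σ, u, v, h⟩ := ih
    exact h.exists_snoc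

/-! ### The random choice of `m` -/

theorem one_sub_div_le_uniformOn_Icc_real {K n : ℕ} (hK : 1 ≤ K) (hn : 1 ≤ n) (hnK : n ≤ K)
    {A : Set ℕ} (hA : ∀ m, n ≤ m → m ∈ A) :
    1 - (n : ℝ) / K ≤ (uniformOn (Set.Icc 1 K)).real A := by
  have hsub : (uniformOn (Set.Icc 1 K)).real (Finset.Icc n K : Set ℕ)
      ≤ (uniformOn (Set.Icc 1 K)).real A :=
    measureReal_mono fun m hm => hA m (Finset.mem_Icc.mp (Finset.mem_coe.mp hm)).1
  refine le_trans ?_ hsub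
  -- The probability of `{n, …, K}` is `(K - n + 1)/K`, which exceeds the required bound by `1/K`.
  have hinter : Finset.Icc 1 K ∩ Finset.Icc n K = Finset.Icc n K := by
    rw [Finset.inter_eq_right]
    exact Finset.Icc_subset_Icc_left hn
  rw [measureReal_def, ← Finset.coe_Icc, uniformOn_apply_finset, hinter, Nat.card_Icc,
    Nat.card_Icc, Nat.add_sub_cancel, ENNReal.toReal_div, ENNReal.toReal_natCast,
    ENNReal.toReal_natCast, Nat.cast_sub (by omega)]
  have hK0 : (0 : ℝ) < K := by exact_mod_cast hK
  rw [le_div_iff₀ hK0, sub_mul, div_mul_cancel₀ _ hK0.ne']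
  push_cast
  linarith

theorem mainTheorem7 (W : Graphon) (hW : ¬ W.toFun =ᵐ[volume] 0)
    (K : ℕ) (hK : 1 ≤ K) (R : ℝ) (hR : 1 ≤ R) (hKR : ∃ n : ℕ, (K : ℝ) / R = n) :
    (∀ m : ℕ, ∃ (σ : Fin m → ℝ) (u v : Fin m → L2I), IsLeadingSingularTriplets W σ u v) ∧
    1 - 1 / R ≤ (uniformOn (Set.Icc 1 K)).real
      {m : ℕ | ∀ (σ : Fin m → ℝ) (u v : Fin m → L2I), IsLeadingSingularTriplets W σ u v →
        cutNorm (fun p => W.toFun p - svdKernel σ u v p) <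
          frobeniusNorm W.toFun * Real.sqrt (R / K)} := by
  refine ⟨exists_isLeadingSingularTriplets W, ?_⟩
  obtain ⟨n, hn⟩ := hKR
  have hK0 : (0 : ℝ) < K := by exact_mod_cast hK
  have hR0 : 0 < R := by linarith
  have hn0 : (0 : ℝ) < n := hn ▸ div_pos hK0 hR0
  have hnK : (n : ℝ) ≤ K := hn ▸ div_le_self hK0.le hR
  have hRn : (n : ℝ) / K = 1 / R := by rw [← hn]; field_simp
  have hRK : R / K = 1 / n := by rw [← hn, one_div_div]
  rw [← hRn]
  refine one_sub_div_le_uniformOn_Icc_real hK (by exact_mod_cast hn0) (by exact_mod_cast hnK)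
    fun m hm σ u v h => h.cutNorm_lt hW (by positivity) ?_
  have hm' : (n : ℝ) ≤ m := by exact_mod_cast hm
  -- The strict inequality comes from `n ≤ m < m + 1`.
  rw [hRK, one_div_mul_eq_div, one_lt_div hn0]
  linarith
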